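/- Let $1<p\le 2$ and $0<\delta\le\frac12$. There is a constant $C_{p,\delta}<\infty$, depending only on $p$ and $\delta$, such that the following holds. Let $I\subset\mathbb{R}$ be a bounded interval of positive length $|I|$ with Lebesgue measure, let $\mathcal{H}$ be a separable (real or complex) Hilbert space, and let $\mathcal{F}_0\subseteq\mathcal{F}_1\subseteq\dots$ be a filtration of the Borel $\sigma$-algebra of $I$ that is regular with parameter $\delta$: $\mathcal{F}_0=\{I,\emptyset\}$, each $\mathcal{F}_n$ is finite, and $|Q|/|J|\ge\delta$ whenever $J$ is an atom of $\mathcal{F}_n$, $Q$ is an atom of $\mathcal{F}_{n+1}$ and $Q\subseteq J$. Put $\mathcal{F}_\infty=\sigma(\bigcup_n\mathcal{F}_n)$. Let $S(I,\mathcal{H})$ be the space of simple $\mathcal{H}$-valued martingales, i.e. martingales $f=\{f_n\}_{n\ge0}$ with respect to $\{\mathcal{F}_n\}$ such that $f_{n+1}=f_n$ for all sufficiently large $n$; put $\|f\|_{L^p}=\sup_n\|f_n\|_{L^p}$ and identify $f$ with its limit function in $L^p(I,\mathcal{F}_\infty,\mathcal{H})$. Let $T$ be an operator of the class $\mathcal{G}(I,\mathcal{H})$,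 i.e. a linear operator from $S(I,\mathcal{H})$ to measurable scalar functions on $I$ (up to a.e. equality) such that (G1) $\|Tf\|_{L^2}\le\|f\|_{L^2}$ for all $f\in S(I,\mathcal{H})$; (G2) if $f\in S(I,\mathcal{H})$ satisfies $f_0=0$ and $f_n-f_{n-1}=\mathbf{1}_{e_n}(f_n-f_{n-1})$ for all $n>0$ with some sets $e_n\in\mathcal{F}_{n-1}$, then $\{|Tf|>0\}\subset\bigcup_{n>0}e_n$ up to a null set. Then $$\|Tf\|_{L^p}\le C_{p,\delta}\,\|f\|_{L^p}\qquad\text{for all } f\in S(I,\mathcal{H}),$$ and $T$ extends to a continuous linear operator from $L^p(I,\mathcal{F}_\infty,\mathcal{H})$ to $L^p(I)$, with norm at most $C_{p,\delta}$. -/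

import Mathlib

open MeasureTheory ProbabilityTheory Filter Topology
open scoped ENNReal NNReal

namespace Gundy

section Filtration

variable {Ω : Type*} {m0 : MeasurableSpace Ω}

/-- `J` is an atom of the `σ`-algebra `m`: a minimal nonempty `m`-measurable set. -/
def IsAtomOf (m : MeasurableSpace Ω) (J : Set Ω) : Prop :=
  MeasurableSet[m] J ∧ J.Nonempty ∧ ∀ s : Set Ω, MeasurableSet[m] s → s ⊆ J → s = ∅ ∨ s = J

/-- The regularity condition with parameter `δ` on a filtration: the initial `σ`-algebra is
trivial, every `σ`-algebra of the filtration is finite, and an atom at time `n + 1` that lies in an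
atom at time `n` carries at least the fraction `δ` of the measure of the latter. -/
structure IsRegular (μ : Measure Ω) (ℱ : Filtration ℕ m0) (δ : ℝ) : Prop where
  zero_eq_bot : ℱ 0 = ⊥
  finite : ∀ n, {s : Set Ω | MeasurableSet[ℱ n] s}.Finite
  ratio_ge : ∀ (n : ℕ) (J Q : Set Ω), IsAtomOf (ℱ n) J → IsAtomOf (ℱ (n + 1)) Q → Q ⊆ J →
    δ ≤ μ.real Q / μ.real J

end Filtration

section Martingale

variable {Ω : Type*} {m0 : MeasurableSpace Ω} (μ : Measure Ω) (ℱ : Filtration ℕ m0)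
variable (𝕜 : Type*) [RCLike 𝕜] (H : Type*) [NormedAddCommGroup H] [InnerProductSpace 𝕜 H]
  [NormedSpace ℝ H] [CompleteSpace H]

/-- The space of simple `H`-valued martingales: the martingales that are eventually constant
in time. -/
def SimpleMartingale : Submodule 𝕜 (ℕ → Ω → H) where
  carrier := {f | Martingale f ℱ μ ∧ ∃ N, ∀ n, N ≤ n → f (n + 1) = f n}
  zero_mem' := ⟨martingale_zero H ℱ μ, 0, fun _ _ => rfl⟩
  add_mem' := by
    rintro f g ⟨hf, N, hN⟩ ⟨hg, M, hM⟩
    refine ⟨hf.add hg, max N M, fun n hn => ?_⟩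
    simp only [Pi.add_apply, hN n (le_trans (le_max_left _ _) hn),
      hM n (le_trans (le_max_right _ _) hn)]
  smul_mem' := by
    rintro c f ⟨hf, N, hN⟩
    refine ⟨⟨fun i => (hf.1 i).const_smul c, fun i j hij => ?_⟩, N, fun n hn => ?_⟩
    · refine (condExp_smul c (f j) (ℱ i)).trans ?_
      filter_upwards [hf.2 i j hij] with x hx
      simp only [Pi.smul_apply, hx]
    · simp only [Pi.smul_apply, hN n hn]

variable {H} in
/-- The `L^p` norm of a sequence of functions, `sup_n ‖f_n‖_{L^p}`, with values in `[0, ∞]`. -/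
noncomputable def martingaleNorm (p : ℝ≥0∞) (f : ℕ → Ω → H) : ℝ≥0∞ :=
  ⨆ n, eLpNorm (f n) p μ

variable {μ ℱ 𝕜 H} in
/-- Gundy's class of linear operators that map simple `H`-valued martingales to (classes of almost
everywhere equal) measurable scalar functions. -/
structure IsGundy (T : SimpleMartingale μ ℱ 𝕜 H →ₗ[𝕜] (Ω →ₘ[μ] 𝕜)) : Prop where
  /-- `T` is a contraction in the `L^2` norm. -/
  norm_le : ∀ f : SimpleMartingale μ ℱ 𝕜 H,
    eLpNorm (T f) 2 μ ≤ martingaleNorm μ 2 (f : ℕ → Ω → H)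
  /-- If `f_0 = 0` and, for `n > 0`, the increment `f_n - f_{n-1}` vanishes outside some
  `e_n ∈ ℱ_{n-1}`, then `T f` vanishes outside the union of the sets `e_n`. -/
  support_subset : ∀ (f : SimpleMartingale μ ℱ 𝕜 H) (e : ℕ → Set Ω),
    (∀ n, MeasurableSet[ℱ n] (e (n + 1))) →
    (f : ℕ → Ω → H) 0 = 0 →
    (∀ n, (f : ℕ → Ω → H) (n + 1) - (f : ℕ → Ω → H) n =
      (e (n + 1)).indicator ((f : ℕ → Ω → H) (n + 1) - (f : ℕ → Ω → H) n)) →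
    ∀ᵐ x ∂μ, T f x ≠ 0 → x ∈ ⋃ n, e (n + 1)

end Martingale

/-- Lebesgue measure on a subset of the real line, as a measure on the subtype. -/
noncomputable def lebesgueOn (I : Set ℝ) : Measure I :=
  (volume : Measure ℝ).comap ((↑) : I → ℝ)

end Gundy

/-! The argument is a Calderón–Zygmund decomposition along the filtration, followed by real
interpolation between `L^1` and `L^2`. Fix a height `t` and let `N` be a time after which `f` is
constant. Stop `f` when the average `E[‖f_N‖ | ℱ_n]` first reaches `t`. The stopped martingale `g`
has norm at most `t / δ`, because regularity lets the averages grow by at most the factor `δ⁻¹` in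
one step, and `g` has limit `f_N` off the stopping set `S N`. The remainder `h = f - g` has
increments only on the predictable sets `S n`, so (G2) makes `T h` vanish off `S N`.

Chebyshev's inequality and (G1) control `T g`, and Doob's maximal inequality controls the measure of
`S N`. Both estimates keep truncations of `f_N` at heights comparable to `t`
(`IsGundy.measure_lt_norm_le`), so integrating against `t ^ (p - 1)` and exchanging integrals gives
the `L^p` bound for `1 < p < 2` (`lintegral_rpow_le_of_distribution_le`). For `p = 2` the bound is
(G1).

The extension uses density: sets from `⋃ ℱ_n` approximate every set of `ℱ_∞` in measure, and their
indicators are limits of simple martingales. -/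

namespace Gundy

/-! ### Atoms of finite σ-algebras and the one-step growth of nonnegative martingales -/

section Atoms

variable {Ω : Type*} {m0 : MeasurableSpace Ω}

/-- Distinct values have distinct fibres, and each fibre is one of finitely many measurable sets. -/
theorem finite_range_of_stronglyMeasurable {β : Type*} [TopologicalSpace β]
    [TopologicalSpace.MetrizableSpace β] {m : MeasurableSpace Ω}
    (hm : {s : Set Ω | MeasurableSet[m] s}.Finite)
    {f : Ω → β} (hf : StronglyMeasurable[m] f) : (Set.range f).Finite := by
  borelize β
  refine Set.Finite.of_finite_image (f := fun c => f ⁻¹' {c}) (hm.subset ?_) ?_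
  · rintro _ ⟨c, -, rfl⟩
    exact hf.measurable (measurableSet_singleton c)
  · rintro _ ⟨x, rfl⟩ c _ h
    have : x ∈ f ⁻¹' {c} := by
      rw [← show f ⁻¹' {f x} = f ⁻¹' {c} from h]; rfl
    exact this

theorem memLp_of_stronglyMeasurable_of_finite {E : Type*} [NormedAddCommGroup E]
    {μ : Measure Ω} [IsFiniteMeasure μ] {m : MeasurableSpace Ω} (hle : m ≤ m0)
    (hm : {s : Set Ω | MeasurableSet[m] s}.Finite)
    {f : Ω → E} (hf : StronglyMeasurable[m] f) (p : ℝ≥0∞) : MemLp f p μ := by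
  obtain ⟨C, hC⟩ := (finite_range_of_stronglyMeasurable hm hf).isBounded.exists_norm_le
  exact MemLp.of_bound (hf.mono hle).aestronglyMeasurable C
    (ae_of_all _ fun x => hC _ ⟨x, rfl⟩)

theorem isAtomOf_measurableAtom {m : MeasurableSpace Ω}
    (hm : {s : Set Ω | MeasurableSet[m] s}.Finite) (x : Ω) :
    IsAtomOf m (@measurableAtom Ω m x) := by
  refine ⟨?_, ⟨x, mem_measurableAtom_self x⟩, fun s hs hsub => ?_⟩
  · have : @measurableAtom Ω m x = ⋂ s ∈ {s : Set Ω | x ∈ s ∧ MeasurableSet[m] s}, s := by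
      ext y; simp [measurableAtom]
    rw [this]
    exact MeasurableSet.biInter (hm.subset fun s hs => hs.2).countable fun s hs => hs.2
  · by_cases hx : x ∈ s
    · exact Or.inr (hsub.antisymm (measurableAtom_subset hs hx))
    · left
      have := measurableAtom_subset hs.compl hx
      exact Set.eq_empty_of_forall_notMem fun y hy => this (hsub hy) hy

theorem eq_of_mem_measurableAtom {β : Type*} [TopologicalSpace β]
    [TopologicalSpace.MetrizableSpace β] {m : MeasurableSpace Ω}
    {f : Ω → β} (hf : StronglyMeasurable[m] f) {x y : Ω} (hy : y ∈ @measurableAtom Ω m x) :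
    f y = f x := by
  borelize β
  exact mem_of_mem_measurableAtom hy (hf.measurable (measurableSet_singleton (f x))) rfl

/-- Along a regular filtration, a nonnegative martingale grows at most by the factor `δ⁻¹` in one
step. -/
theorem IsRegular.martingale_succ_le {μ : Measure Ω} [IsFiniteMeasure μ] {ℱ : Filtration ℕ m0}
    {δ : ℝ} (hR : IsRegular μ ℱ δ) (hδ : 0 < δ) {a : ℕ → Ω → ℝ} (ha : Martingale a ℱ μ)
    (hnn : ∀ n x, 0 ≤ a n x) (n : ℕ) (x : Ω) : a (n + 1) x ≤ a n x / δ := by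
  set A := @measurableAtom Ω (ℱ n) x
  set B := @measurableAtom Ω (ℱ (n + 1)) x
  have hA : IsAtomOf (ℱ n) A := isAtomOf_measurableAtom (hR.finite n) x
  have hB : IsAtomOf (ℱ (n + 1)) B := isAtomOf_measurableAtom (hR.finite (n + 1)) x
  have hBA : B ⊆ A :=
    @measurableAtom_subset Ω (ℱ (n + 1)) _ _ (ℱ.mono n.le_succ _ hA.1)
      (@mem_measurableAtom_self Ω (ℱ n) x)
  have hratio := hR.ratio_ge n A B hA hB hBA
  -- If `A` were null, the quotient in `hratio` would be `0` by the convention on division, against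
  -- `0 < δ`.
  have hA0 : 0 < μ.real A := by
    rcases (measureReal_nonneg (μ := μ) (s := A)).eq_or_lt with h | h
    · rw [← h, div_zero] at hratio; linarith
    · exact h
  rw [le_div_iff₀ hA0] at hratio
  have hAm := ℱ.le _ _ hA.1
  have hBm := ℱ.le _ _ hB.1
  -- The process is constant on atoms, so `δ μ(A) a_{n+1}(x) ≤ μ(B) a_{n+1}(x) = ∫_B a_{n+1} ≤ ∫_A
  -- a_{n+1} = ∫_A a_n = μ(A) a_n(x)`.
  have h1 : ∫ y in B, a (n + 1) y ∂μ = μ.real B * a (n + 1) x := by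
    rw [setIntegral_congr_fun hBm fun y hy => eq_of_mem_measurableAtom (ha.1 (n + 1)) hy]
    simp
  have h2 : ∫ y in A, a n y ∂μ = μ.real A * a n x := by
    rw [setIntegral_congr_fun hAm fun y hy => eq_of_mem_measurableAtom (ha.1 n) hy]
    simp
  have h3 : ∫ y in B, a (n + 1) y ∂μ ≤ ∫ y in A, a (n + 1) y ∂μ :=
    setIntegral_mono_set (ha.integrable _).integrableOn (ae_of_all _ fun y => hnn _ y)
      hBA.eventuallyLE
  rw [← ha.setIntegral_eq n.le_succ hA.1, h1, h2] at h3
  rw [le_div_iff₀ hδ]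
  have h4 : δ * μ.real A * a (n + 1) x ≤ μ.real A * a n x :=
    (mul_le_mul_of_nonneg_right hratio (hnn _ _)).trans h3
  refine le_of_mul_le_mul_left ?_ hA0
  linarith

end Atoms

/-! ### Martingale transforms by indicators of predictable sets -/

section Transform

variable {Ω : Type*} {m0 : MeasurableSpace Ω} {μ : Measure Ω} {ℱ : Filtration ℕ m0}
variable {E : Type*} [NormedAddCommGroup E]

/-- The part of a process that is accumulated on the sets `S k`: the transform of `f` with
increments `𝟙_{S k} (f (k + 1) - f k)`. -/
noncomputable def incrementsOn (S : ℕ → Set Ω) (f : ℕ → Ω → E) (n : ℕ) : Ω → E :=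
  ∑ k ∈ Finset.range n, (S k).indicator (f (k + 1) - f k)

theorem incrementsOn_succ_sub (S : ℕ → Set Ω) (f : ℕ → Ω → E) (n : ℕ) :
    incrementsOn S f (n + 1) - incrementsOn S f n = (S n).indicator (f (n + 1) - f n) := by
  simp [incrementsOn, Finset.sum_range_succ]

theorem martingale_incrementsOn [NormedSpace ℝ E] [CompleteSpace E] [IsFiniteMeasure μ]
    {S : ℕ → Set Ω} (hS : ∀ n, MeasurableSet[ℱ n] (S n)) {f : ℕ → Ω → E}
    (hf : Martingale f ℱ μ) : Martingale (incrementsOn S f) ℱ μ := by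
  refine martingale_of_condExp_sub_eq_zero_nat (fun n => ?_) (fun n => ?_) fun n => ?_
  · refine Finset.stronglyMeasurable_sum _ fun k hk => ?_
    have hk := Finset.mem_range.1 hk
    exact (((hf.1 (k + 1)).mono (ℱ.mono hk)).sub ((hf.1 k).mono (ℱ.mono hk.le))).indicator
      (ℱ.mono hk.le _ (hS k))
  · exact integrable_finsetSum' _ fun k _ =>
      ((hf.integrable _).sub (hf.integrable _)).indicator (ℱ.le _ _ (hS k))
  · rw [incrementsOn_succ_sub]
    refine (condExp_indicator ((hf.integrable _).sub (hf.integrable _)) (hS n)).trans ?_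
    filter_upwards [condExp_sub (hf.integrable (n + 1)) (hf.integrable n) (ℱ n),
      hf.2 n (n + 1) n.le_succ, hf.2 n n le_rfl] with x h1 h2 h3
    simp [h1, h2, h3]

theorem incrementsOn_apply_eq_zero {S : ℕ → Set Ω} (hS : Monotone S) (f : ℕ → Ω → E) {n : ℕ}
    {x : Ω} (hx : x ∉ S n) : incrementsOn S f (n + 1) x = 0 := by
  rw [incrementsOn, Finset.sum_apply]
  refine Finset.sum_eq_zero fun k hk => ?_
  exact Set.indicator_of_notMem
    (fun h => hx (hS (Nat.lt_succ_iff.1 (Finset.mem_range.1 hk)) h)) _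

/-- For increasing `S`, the difference is `f` stopped at the first `n` with `x ∈ S n`: it is frozen
from then on and equals `f` before. The step that leads to the stopping time starts outside `S`,
hence the bound on `f (n + 1)` in `hK`. -/
theorem norm_sub_incrementsOn_le {S : ℕ → Set Ω} (hS : Monotone S) {f : ℕ → Ω → E} {x : Ω}
    {K : ℝ} (h0 : ‖f 0 x‖ ≤ K) (hK : ∀ n, x ∉ S n → ‖f (n + 1) x‖ ≤ K) (n : ℕ) :
    ‖f n x - incrementsOn S f n x‖ ≤ K := by
  induction n with
  | zero => simpa [incrementsOn] using h0
  | succ n ih =>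
    by_cases hx : x ∈ S n
    · have := congrFun (incrementsOn_succ_sub S f n) x
      rw [Pi.sub_apply, Set.indicator_of_mem hx, Pi.sub_apply, sub_eq_sub_iff_add_eq_add] at this
      rwa [show f (n + 1) x - incrementsOn S f (n + 1) x = f n x - incrementsOn S f n x by
        rw [sub_eq_sub_iff_add_eq_add, ← this, add_comm]]
    · rw [incrementsOn_apply_eq_zero hS f hx, sub_zero]
      exact hK n hx

/-- Each earlier `f n` is a conditional expectation of `f N`, and conditional expectation contracts
`L^p`. -/
theorem martingaleNorm_eq_of_eventually [NormedSpace ℝ E] [CompleteSpace E]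
    {f : ℕ → Ω → E} (hf : Martingale f ℱ μ) {N : ℕ} (hN : ∀ n, N ≤ n → f n = f N)
    {p : ℝ≥0∞} (hp : 1 ≤ p) : martingaleNorm μ p f = eLpNorm (f N) p μ := by
  refine le_antisymm (iSup_le fun n => ?_) (le_iSup (fun n => eLpNorm (f n) p μ) N)
  rcases le_total n N with h | h
  · rw [← eLpNorm_congr_ae (hf.2 n N h)]
    exact eLpNorm_condExp_le_eLpNorm _ hp
  · rw [hN n h]

end Transform

/-! ### Stopping at height `t` and the maximal inequality -/

section StoppingDecomposition

variable {Ω : Type*} {m0 : MeasurableSpace Ω} {μ : Measure Ω} {ℱ : Filtration ℕ m0}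

/-- The stopping sets at height `t` of a simple martingale along a regular filtration: `S n` is the
set on which one of the averages of the norm up to time `n` reaches `t`. -/
theorem IsRegular.exists_stopping_sets [IsFiniteMeasure μ] {E : Type*} [NormedAddCommGroup E]
    [NormedSpace ℝ E] [CompleteSpace E] {δ : ℝ} (hR : IsRegular μ ℱ δ) (hδ0 : 0 < δ) (hδ1 : δ ≤ 1)
    {f : ℕ → Ω → E} (hf : Martingale f ℱ μ) {N : ℕ} (hN : ∀ n, N ≤ n → f n = f N) {t : ℝ}
    (ht : 0 < t) :
    ∃ S : ℕ → Set Ω, Monotone S ∧ (∀ n, MeasurableSet[ℱ n] (S n)) ∧ (∀ n, S n ⊆ S N) ∧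
      (∀ x, x ∉ S N → ‖f N x‖ < t) ∧
      ENNReal.ofReal t * μ (S N) ≤ ∫⁻ x in S N, ENNReal.ofReal ‖f N x‖ ∂μ ∧
      (S 0 = ∅ → ∀ᵐ x ∂μ, ∀ n, ‖f n x - incrementsOn S f n x‖ ≤ t / δ) := by
  set w : Ω → ℝ := fun x => ‖f N x‖ with hw
  have hwint : Integrable w μ := (hf.integrable N).norm
  -- The norm selects a version of the conditional expectation that is nonnegative at every point,
  -- as `IsRegular.martingale_succ_le` requires.
  set a : ℕ → Ω → ℝ := fun n x => ‖(μ[w | ℱ n]) x‖ with ha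
  have haeq : ∀ n, a n =ᵐ[μ] μ[w | ℱ n] := fun n => by
    filter_upwards [condExp_nonneg (m := ℱ n) (ae_of_all μ fun x => norm_nonneg (f N x))]
      with x hx
    exact Real.norm_of_nonneg hx
  have hameas : ∀ n, StronglyMeasurable[ℱ n] (a n) := fun n => stronglyMeasurable_condExp.norm
  have hamart : Martingale a ℱ μ :=
    (martingale_condExp w ℱ μ).congr hameas fun n => (haeq n).symm
  have ha0 : ∀ n x, 0 ≤ a n x := fun n x => norm_nonneg _
  have haN : ∀ n, N ≤ n → a n = w := fun n hn => by
    funext x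
    simp only [ha]
    rw [condExp_of_stronglyMeasurable (ℱ.le n) ((hf.1 N).norm.mono (ℱ.mono hn)) hwint]
    exact Real.norm_of_nonneg (norm_nonneg _)
  have hfa : ∀ᵐ x ∂μ, ∀ n, ‖f n x‖ ≤ a n x := by
    rw [ae_all_iff]
    intro n
    rcases le_total n N with h | h
    · filter_upwards [hf.2 n N h, norm_condExp_le (μ := μ) (m := ℱ n) (f N)] with x h1 h2
      rw [← h1]
      exact h2.trans (Real.le_norm_self _)
    · rw [hN n h, haN n h]
      exact ae_of_all _ fun x => le_rfl
  set S : ℕ → Set Ω := fun n => {x | ∃ k ≤ n, t ≤ a k x} with hS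
  have hSmono : Monotone S := fun n m hnm x ⟨k, hk, hx⟩ => ⟨k, hk.trans hnm, hx⟩
  have hSmeas : ∀ n, MeasurableSet[ℱ n] (S n) := fun n => by
    have : S n = ⋃ k ∈ Set.Iic n, {x | t ≤ a k x} := by ext x; simp [hS]
    rw [this]
    refine MeasurableSet.biUnion (Set.to_countable _) fun k hk => ?_
    exact ℱ.mono hk _ (measurableSet_le measurable_const (hameas k).measurable)
  refine ⟨S, hSmono, hSmeas, fun n x ⟨k, hk, hx⟩ => ?_, fun x hx => ?_, ?_, fun h0 => ?_⟩
  · rcases le_total k N with h | h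
    · exact ⟨k, h, hx⟩
    · exact ⟨N, le_rfl, by rwa [haN N le_rfl, ← haN k h]⟩
  · have : ¬ t ≤ a N x := fun h => hx ⟨N, le_rfl, h⟩
    rw [haN N le_rfl] at this
    exact not_le.1 this
  -- Doob's inequality is needed with the integral over `S N` only; this allows small values of `‖f
  -- N‖` to be absorbed later.
  · have := maximal_ineq hamart.submartingale (fun n x => ha0 n x) (ε := t.toNNReal) N
    have hset : {x | (t.toNNReal : ℝ) ≤ (Finset.range (N + 1)).sup' Finset.nonempty_range_add_one
        fun k => a k x} = S N := by
      ext x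
      simp [hS, Finset.le_sup'_iff, Real.coe_toNNReal t ht.le]
    rw [hset, haN N le_rfl, ofReal_integral_eq_lintegral_ofReal hwint.integrableOn
      (ae_of_all _ fun x => norm_nonneg _)] at this
    exact this
  · filter_upwards [hfa] with x hx
    have htδ : t ≤ t / δ := by rw [le_div_iff₀ hδ0]; nlinarith
    refine norm_sub_incrementsOn_le hSmono ?_ fun n hn => ?_
    · have : ¬ t ≤ a 0 x := fun h => by
        have h1 : x ∈ S 0 := ⟨0, le_rfl, h⟩
        rw [h0] at h1
        exact h1
      exact (hx 0).trans ((not_le.1 this).le.trans htδ)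
    · have : ¬ t ≤ a n x := fun h => hn ⟨n, le_rfl, h⟩
      refine (hx _).trans ((hR.martingale_succ_le hδ0 hamart ha0 n x).trans ?_)
      exact div_le_div_of_nonneg_right (not_le.1 this).le hδ0.le

/-- The values `w ≤ t / 2` contribute at most `(t / 2) μ(A)` to the integral over `A`, which is half
of the left side of `h` and is finite, so it can be subtracted. -/
theorem mul_measure_le_lintegral_large_part [IsFiniteMeasure μ] {w : Ω → ℝ} {A : Set Ω}
    {t : ℝ} (ht : 0 < t)
    (h : ENNReal.ofReal t * μ A ≤ ∫⁻ x in A, ENNReal.ofReal (w x) ∂μ) :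
    μ A ≤ 2 * ((∫⁻ x, if t / 2 < w x then ENNReal.ofReal (w x) else 0 ∂μ) *
      ENNReal.ofReal t⁻¹) := by
  set X := ∫⁻ x, if t / 2 < w x then ENNReal.ofReal (w x) else 0 ∂μ
  have h1 : ∫⁻ x in A, ENNReal.ofReal (w x) ∂μ ≤ X + ENNReal.ofReal (t / 2) * μ A := by
    calc ∫⁻ x in A, ENNReal.ofReal (w x) ∂μ
        ≤ ∫⁻ x in A, ((if t / 2 < w x then ENNReal.ofReal (w x) else 0) +
            ENNReal.ofReal (t / 2)) ∂μ := by
          refine lintegral_mono fun x => ?_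
          split_ifs with hx
          · exact le_self_add
          · rw [zero_add]
            exact ENNReal.ofReal_le_ofReal (not_lt.1 hx)
      _ = (∫⁻ x in A, (if t / 2 < w x then ENNReal.ofReal (w x) else 0) ∂μ) +
            ENNReal.ofReal (t / 2) * μ A := by
          rw [lintegral_add_right _ measurable_const]
          simp
      _ ≤ X + ENNReal.ofReal (t / 2) * μ A := by
          gcongr
          exact setLIntegral_le_lintegral _ _
  have h2 : ENNReal.ofReal (t / 2) * μ A ≤ X := by
    have h3 := h.trans h1
    nth_rw 1 [← add_halves t] at h3
    rw [ENNReal.ofReal_add (by positivity) (by positivity), add_mul] at h3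
    exact (ENNReal.add_le_add_iff_right
      (ENNReal.mul_ne_top ENNReal.ofReal_ne_top (measure_ne_top _ _))).1 h3
  calc μ A = 2 * (ENNReal.ofReal (t / 2) * μ A * ENNReal.ofReal t⁻¹) := by
        rw [mul_right_comm, ← ENNReal.ofReal_mul (by positivity), ← mul_assoc,
          show t / 2 * t⁻¹ = 2⁻¹ by field_simp,
          show (2 : ℝ≥0∞) = ENNReal.ofReal 2 by simp, ← ENNReal.ofReal_mul zero_le_two]
        simp
    _ ≤ _ := by gcongr

end StoppingDecomposition

/-! ### The distributional estimate for `T f` -/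

section Distribution

variable {Ω : Type*} {m0 : MeasurableSpace Ω} {μ : Measure Ω} {ℱ : Filtration ℕ m0}
variable {𝕜 : Type*} [RCLike 𝕜] {H : Type*} [NormedAddCommGroup H] [InnerProductSpace 𝕜 H]
  [NormedSpace ℝ H] [CompleteSpace H]

theorem SimpleMartingale.exists_forall_ge_eq (f : SimpleMartingale μ ℱ 𝕜 H) :
    ∃ N, ∀ n, N ≤ n → (f : ℕ → Ω → H) n = (f : ℕ → Ω → H) N := by
  obtain ⟨N, hN⟩ := f.2.2
  refine ⟨N, fun n hn => ?_⟩
  induction n, hn using Nat.le_induction with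
  | base => rfl
  | succ n hn ih => rw [hN n hn, ih]

theorem lintegral_enorm_sq_eq {E : Type*} [NormedAddCommGroup E] (g : Ω → E) :
    ∫⁻ x, ‖g x‖ₑ ^ 2 ∂μ = eLpNorm g 2 μ ^ 2 := by
  have := eLpNorm_nnreal_pow_eq_lintegral (μ := μ) (f := g) (p := 2) two_ne_zero
  simp only [NNReal.coe_ofNat, ENNReal.rpow_ofNat] at this
  exact this.symm

/-- The distribution of `T f` at height `t` is controlled by the truncations of `f` at height
comparable to `t`. -/
theorem IsGundy.measure_lt_norm_le [IsFiniteMeasure μ] {δ : ℝ} (hR : IsRegular μ ℱ δ)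
    (hδ0 : 0 < δ) (hδ1 : δ ≤ 1) {T : SimpleMartingale μ ℱ 𝕜 H →ₗ[𝕜] (Ω →ₘ[μ] 𝕜)} (hT : IsGundy T)
    (f : SimpleMartingale μ ℱ 𝕜 H) {N : ℕ}
    (hN : ∀ n, N ≤ n → (f : ℕ → Ω → H) n = (f : ℕ → Ω → H) N) {t : ℝ} (ht : 0 < t) :
    μ {x | t < ‖T f x‖} ≤
      (∫⁻ x, if ‖(f : ℕ → Ω → H) N x‖ ≤ t then
        ENNReal.ofReal (‖(f : ℕ → Ω → H) N x‖ ^ 2) else 0 ∂μ) * ENNReal.ofReal (t ^ 2)⁻¹ +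
      ENNReal.ofReal (2 * (1 + (δ ^ 2)⁻¹)) *
        ((∫⁻ x, if t / 2 < ‖(f : ℕ → Ω → H) N x‖ then
          ENNReal.ofReal ‖(f : ℕ → Ω → H) N x‖ else 0 ∂μ) * ENNReal.ofReal t⁻¹) := by
  have hf := f.2.1
  obtain ⟨S, hSmono, hSmeas, hSN, hSlt, hSmax, hSg⟩ :=
    hR.exists_stopping_sets hδ0 hδ1 hf hN ht
  have hSm : MeasurableSet (S N) := ℱ.le _ _ (hSmeas N)
  set X₁ := ∫⁻ x, if ‖(f : ℕ → Ω → H) N x‖ ≤ t then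
        ENNReal.ofReal (‖(f : ℕ → Ω → H) N x‖ ^ 2) else 0 ∂μ
  set X₂ := (∫⁻ x, if t / 2 < ‖(f : ℕ → Ω → H) N x‖ then
          ENNReal.ofReal ‖(f : ℕ → Ω → H) N x‖ else 0 ∂μ) * ENNReal.ofReal t⁻¹
  have hS2 : μ (S N) ≤ 2 * X₂ := mul_measure_le_lintegral_large_part ht hSmax
  suffices hmain : μ {x | t < ‖T f x‖} ≤
      X₁ * ENNReal.ofReal (t ^ 2)⁻¹ + ENNReal.ofReal (1 + (δ ^ 2)⁻¹) * μ (S N) by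
    refine hmain.trans (add_le_add le_rfl ?_)
    refine (mul_le_mul_right hS2 _).trans (le_of_eq ?_)
    rw [ENNReal.ofReal_mul zero_le_two, ENNReal.ofReal_ofNat]
    ring
  have hS0 : S 0 = ∅ ∨ S 0 = Set.univ := by
    have := hSmeas 0
    rwa [hR.zero_eq_bot, MeasurableSpace.measurableSet_bot_iff] at this
  rcases hS0 with hS0 | hS0
  swap
  -- Stopping occurs at time `0`, where regularity gives no bound on `f 0`. But then `S N` is the
  -- whole space, and the coefficient of its measure is at least `1`.
  · have huniv : S N = Set.univ := Set.univ_subset_iff.1 (hS0 ▸ hSN 0)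
    refine le_trans ?_ le_add_self
    rw [huniv]
    refine (measure_mono (Set.subset_univ _)).trans (le_mul_of_one_le_left' ?_)
    rw [ENNReal.one_le_ofReal]
    have : 0 ≤ (δ ^ 2)⁻¹ := by positivity
    linarith
  have hhN : ∀ n, N ≤ n → incrementsOn S (f : ℕ → Ω → H) (n + 1) =
      incrementsOn S (f : ℕ → Ω → H) n := fun n hn => by
    rw [← sub_eq_zero, incrementsOn_succ_sub, hN (n + 1) (by omega), hN n hn, sub_self]
    simp
  let h : SimpleMartingale μ ℱ 𝕜 H :=
    ⟨incrementsOn S (f : ℕ → Ω → H), martingale_incrementsOn hSmeas hf, N, hhN⟩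
  set g := f - h with hg
  have hgc : ∀ n x, (g : ℕ → Ω → H) n x =
      (f : ℕ → Ω → H) n x - incrementsOn S (f : ℕ → Ω → H) n x := fun n x => rfl
  have hgN : ∀ n, N ≤ n → (g : ℕ → Ω → H) n = (g : ℕ → Ω → H) N := fun n hn => by
    induction n, hn using Nat.le_induction with
    | base => rfl
    | succ n hn ih =>
      rw [← ih]
      funext x
      rw [hgc, hgc, hhN n hn, hN (n + 1) (by omega), hN n hn]
  have hsupp : ∀ᵐ x ∂μ, T h x ≠ 0 → x ∈ S N := by
    -- The index shift gives `e (n + 1) = S n`, which is `ℱ n`-measurable as (G2) demands.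
    have := hT.support_subset h (fun n => S (n - 1)) (fun n => by simpa using hSmeas n)
      (by simp [h, incrementsOn]) (fun n => by
        change incrementsOn S _ (n + 1) - incrementsOn S _ n = (S (n + 1 - 1)).indicator
          (incrementsOn S _ (n + 1) - incrementsOn S _ n)
        rw [incrementsOn_succ_sub, Nat.add_sub_cancel, Set.indicator_indicator, Set.inter_self])
    filter_upwards [this] with x hx hne
    obtain ⟨n, hn⟩ := Set.mem_iUnion.1 (hx hne)
    exact hSN _ hn
  have hTf : T f =ᵐ[μ] T g + T h := by
    rw [show f = g + h by rw [hg, sub_add_cancel], map_add]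
    exact AEEqFun.coeFn_add _ _
  have hL2 : ∫⁻ x, ‖T g x‖ₑ ^ 2 ∂μ ≤ X₁ + ENNReal.ofReal ((t / δ) ^ 2) * μ (S N) := by
    rw [lintegral_enorm_sq_eq]
    calc eLpNorm (T g) 2 μ ^ 2 ≤ martingaleNorm μ 2 (g : ℕ → Ω → H) ^ 2 := by
          gcongr
          exact hT.norm_le g
      _ = ∫⁻ x, ‖(g : ℕ → Ω → H) N x‖ₑ ^ 2 ∂μ := by
          rw [martingaleNorm_eq_of_eventually g.2.1 hgN one_le_two, lintegral_enorm_sq_eq]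
      _ ≤ ∫⁻ x, ((if ‖(f : ℕ → Ω → H) N x‖ ≤ t then
            ENNReal.ofReal (‖(f : ℕ → Ω → H) N x‖ ^ 2) else 0) +
            (S N).indicator (fun _ => ENNReal.ofReal ((t / δ) ^ 2)) x) ∂μ := by
          refine lintegral_mono_ae ?_
          filter_upwards [hSg hS0] with x hx
          rw [hgc]
          -- On `S N` the stopped martingale is bounded by `t / δ`. Off `S N` the remainder vanishes
          -- at time `N + 1`, hence at time `N`, and `g N = f N` has norm below `t`.
          by_cases hxS : x ∈ S N
          · rw [Set.indicator_of_mem hxS, ← ofReal_norm, ← ENNReal.ofReal_pow (norm_nonneg _)]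
            refine le_trans (ENNReal.ofReal_le_ofReal ?_) le_add_self
            exact pow_le_pow_left₀ (norm_nonneg _) (hx N) 2
          · rw [Set.indicator_of_notMem hxS, add_zero, if_pos (hSlt x hxS).le, ← hhN N le_rfl,
              incrementsOn_apply_eq_zero hSmono _ hxS, sub_zero, ← ofReal_norm,
              ← ENNReal.ofReal_pow (norm_nonneg _)]
      _ = X₁ + ENNReal.ofReal ((t / δ) ^ 2) * μ (S N) := by
          rw [lintegral_add_right _ (measurable_const.indicator hSm),
            lintegral_indicator_const hSm]
  have hcheb : μ {x | t < ‖T g x‖} ≤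
      X₁ * ENNReal.ofReal (t ^ 2)⁻¹ + ENNReal.ofReal (δ ^ 2)⁻¹ * μ (S N) := by
    have h1 := mul_meas_ge_le_lintegral₀ (μ := μ) (f := fun x => ‖T g x‖ₑ ^ 2)
      ((T g).aestronglyMeasurable.enorm.pow_const 2) (ENNReal.ofReal (t ^ 2))
    have h2 : μ {x | t < ‖T g x‖} ≤ μ {x | ENNReal.ofReal (t ^ 2) ≤ ‖T g x‖ₑ ^ 2} := by
      refine measure_mono fun x hx => ?_
      have hx : t < ‖T g x‖ := hx
      change ENNReal.ofReal (t ^ 2) ≤ ‖T g x‖ₑ ^ 2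
      rw [← ofReal_norm, ← ENNReal.ofReal_pow (norm_nonneg _)]
      exact ENNReal.ofReal_le_ofReal (pow_le_pow_left₀ ht.le hx.le 2)
    have h3 : ENNReal.ofReal (t ^ 2) * μ {x | t < ‖T g x‖} ≤
        X₁ + ENNReal.ofReal ((t / δ) ^ 2) * μ (S N) :=
      (mul_le_mul_right h2 _).trans (h1.trans hL2)
    calc μ {x | t < ‖T g x‖}
        = ENNReal.ofReal (t ^ 2) * μ {x | t < ‖T g x‖} * ENNReal.ofReal (t ^ 2)⁻¹ := by
          rw [mul_right_comm, ← ENNReal.ofReal_mul (by positivity),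
            mul_inv_cancel₀ (by positivity), ENNReal.ofReal_one, one_mul]
      _ ≤ (X₁ + ENNReal.ofReal ((t / δ) ^ 2) * μ (S N)) * ENNReal.ofReal (t ^ 2)⁻¹ := by gcongr
      _ = _ := by
          rw [add_mul, mul_right_comm, ← ENNReal.ofReal_mul (by positivity)]
          congr 3
          field_simp
  have hsub : ({x | t < ‖T f x‖} : Set Ω) ≤ᵐ[μ] ({x | t < ‖T g x‖} ∪ S N : Set Ω) := by
    filter_upwards [hTf, hsupp] with x h1 h2 h3
    by_cases hx : x ∈ S N
    · exact Or.inr hx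
    · left
      have h4 : T h x = 0 := by
        by_contra h
        exact hx (h2 h)
      have h3 : t < ‖T f x‖ := h3
      rw [h1, Pi.add_apply, h4, add_zero] at h3
      exact h3
  calc μ {x | t < ‖T f x‖} ≤ μ {x | t < ‖T g x‖} + μ (S N) :=
        (measure_mono_ae hsub).trans (measure_union_le _ _)
    _ ≤ X₁ * ENNReal.ofReal (t ^ 2)⁻¹ + ENNReal.ofReal (δ ^ 2)⁻¹ * μ (S N) + μ (S N) := by
        gcongr
    _ = _ := by
        rw [ENNReal.ofReal_add zero_le_one (by positivity), ENNReal.ofReal_one]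
        ring

end Distribution

/-! ### Real interpolation by integrating the distributional estimate -/

section Interpolation

/-- Convergence at infinity of `u ^ 2 ∫_u^∞ t ^ (p - 3) dt = u ^ p / (2 - p)` is where `p < 2`
enters. -/
theorem lintegral_Ioi_indicator_rpow_sub_three {p : ℝ} (hp2 : p < 2) {u : ℝ} (hu : 0 ≤ u) :
    ∫⁻ t in Set.Ioi (0 : ℝ), (if u ≤ t then ENNReal.ofReal (u ^ 2 * t ^ (p - 3)) else 0) ≤
      ENNReal.ofReal (1 / (2 - p)) * ENNReal.ofReal (u ^ p) := by
  rcases hu.eq_or_lt with rfl | hu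
  · simp
  have h1 : ∀ t, (if u ≤ t then ENNReal.ofReal (u ^ 2 * t ^ (p - 3)) else 0) =
      (Set.Ici u).indicator (fun t => ENNReal.ofReal (u ^ 2 * t ^ (p - 3))) t := fun t => by
    simp [Set.indicator_apply]
  simp_rw [h1]
  refine (setLIntegral_le_lintegral _ _).trans ?_
  rw [lintegral_indicator measurableSet_Ici, setLIntegral_congr Ioi_ae_eq_Ici.symm,
    ← ofReal_integral_eq_lintegral_ofReal
      ((integrableOn_Ioi_rpow_of_lt (by linarith) hu).const_mul _)
      ((ae_restrict_iff' measurableSet_Ioi).2 (ae_of_all _ fun t ht => by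
        have := hu.trans ht
        positivity)),
    integral_const_mul, integral_Ioi_rpow_of_lt (by linarith) hu, ← ENNReal.ofReal_mul (by
      rw [one_div, inv_nonneg]; linarith)]
  refine ENNReal.ofReal_le_ofReal (le_of_eq ?_)
  have h2 : u ^ p = u ^ (p - 3 + 1) * u ^ 2 := by
    rw [← Real.rpow_two, ← Real.rpow_add hu]
    ring_nf
  rw [h2, show p - 3 + 1 = -(2 - p) by ring, neg_div_neg_eq]
  ring

/-- Convergence at zero of `u ∫_0^{2u} t ^ (p - 2) dt` is where `1 < p` enters. -/
theorem lintegral_Ioi_indicator_rpow_sub_two {p : ℝ} (hp1 : 1 < p) {u : ℝ} (hu : 0 ≤ u) :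
    ∫⁻ t in Set.Ioi (0 : ℝ), (if t / 2 < u then ENNReal.ofReal (u * t ^ (p - 2)) else 0) ≤
      ENNReal.ofReal (2 ^ (p - 1) / (p - 1)) * ENNReal.ofReal (u ^ p) := by
  have h1 : ∀ t, (if t / 2 < u then ENNReal.ofReal (u * t ^ (p - 2)) else 0) =
      (Set.Iio (2 * u)).indicator (fun t => ENNReal.ofReal (u * t ^ (p - 2))) t := fun t => by
    simp [Set.indicator_apply, div_lt_iff₀, mul_comm]
  simp_rw [h1]
  have h2u : 0 ≤ 2 * u := by positivity
  have hint : IntervalIntegrable (fun t : ℝ => t ^ (p - 2)) volume 0 (2 * u) :=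
    intervalIntegral.intervalIntegrable_rpow' (by linarith)
  rw [setLIntegral_indicator measurableSet_Iio, Set.inter_comm, Set.Ioi_inter_Iio,
    setLIntegral_congr Ioo_ae_eq_Ioc,
    ← ofReal_integral_eq_lintegral_ofReal
      (((intervalIntegrable_iff_integrableOn_Ioc_of_le h2u).1 hint).const_mul _)
      ((ae_restrict_iff' measurableSet_Ioc).2 (ae_of_all _ fun t ht => by
        have := ht.1
        positivity)),
    integral_const_mul, ← intervalIntegral.integral_of_le h2u,
    integral_rpow (Or.inl (by linarith)), ← ENNReal.ofReal_mul (by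
      have : 0 < p - 1 := by linarith
      positivity)]
  refine ENNReal.ofReal_le_ofReal (le_of_eq ?_)
  rw [show p - 2 + 1 = p - 1 by ring, Real.zero_rpow (by linarith), sub_zero,
    Real.mul_rpow zero_le_two hu]
  rcases hu.eq_or_lt with rfl | hu
  · rw [Real.zero_rpow (by linarith : p ≠ 0)]; simp
  · have h2 : u ^ p = u ^ (p - 1) * u := by
      rw [← Real.rpow_add_one hu.ne', sub_add_cancel]
    rw [h2]
    ring

/-- Interpolation between weak-type estimates: a distributional bound of `v` by the truncations of
`u` at the corresponding level gives an `L^p` bound for `1 < p < 2`. -/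
theorem lintegral_rpow_le_of_distribution_le {Ω : Type*} {m0 : MeasurableSpace Ω} {μ : Measure Ω}
    [SFinite μ] {p : ℝ} (hp1 : 1 < p) (hp2 : p < 2) {u v : Ω → ℝ} (hu : Measurable u)
    (hu0 : ∀ x, 0 ≤ u x) (hv : AEMeasurable v μ) (hv0 : ∀ x, 0 ≤ v x) (c : ℝ≥0∞)
    (h : ∀ t : ℝ, 0 < t → μ {x | t < v x} ≤
      (∫⁻ x, if u x ≤ t then ENNReal.ofReal (u x ^ 2) else 0 ∂μ) * ENNReal.ofReal (t ^ 2)⁻¹ +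
      c * ((∫⁻ x, if t / 2 < u x then ENNReal.ofReal (u x) else 0 ∂μ) * ENNReal.ofReal t⁻¹)) :
    ∫⁻ x, ENNReal.ofReal (v x ^ p) ∂μ ≤
      ENNReal.ofReal p * (ENNReal.ofReal (1 / (2 - p)) +
        c * ENNReal.ofReal (2 ^ (p - 1) / (p - 1))) * ∫⁻ x, ENNReal.ofReal (u x ^ p) ∂μ := by
  -- Layer cake: `∫ v ^ p = p ∫_0^∞ μ{v > t} t ^ (p - 1) dt`. After the distributional bound and
  -- Tonelli, the inner integrals over `t` are those of the two preceding lemmas.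
  rw [lintegral_rpow_eq_lintegral_meas_lt_mul μ (ae_of_all _ hv0) hv (by linarith), mul_assoc]
  gcongr
  have key : ∀ t ∈ Set.Ioi (0 : ℝ), μ {x | t < v x} * ENNReal.ofReal (t ^ (p - 1)) ≤
      (∫⁻ x, (if u x ≤ t then ENNReal.ofReal (u x ^ 2 * t ^ (p - 3)) else 0) ∂μ) +
      c * ∫⁻ x, (if t / 2 < u x then ENNReal.ofReal (u x * t ^ (p - 2)) else 0) ∂μ := by
    intro t ht
    have ht : 0 < t := ht
    refine (mul_le_mul_left (h t ht) _).trans (le_of_eq ?_)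
    rw [add_mul, mul_assoc, mul_assoc, mul_assoc, ← ENNReal.ofReal_mul (by positivity),
      ← ENNReal.ofReal_mul (by positivity), ← lintegral_mul_const' _ _ ENNReal.ofReal_ne_top,
      ← lintegral_mul_const' _ _ ENNReal.ofReal_ne_top]
    have e1 : (t ^ 2)⁻¹ * t ^ (p - 1) = t ^ (p - 3) := by
      rw [show p - 1 = (p - 3) + 2 by ring, Real.rpow_add ht, Real.rpow_two]
      field_simp
    have e2 : t⁻¹ * t ^ (p - 1) = t ^ (p - 2) := by
      rw [show p - 1 = (p - 2) + 1 by ring, Real.rpow_add ht, Real.rpow_one]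
      field_simp
    rw [e1, e2]
    congr 2
    · funext x
      rw [ite_mul, zero_mul, ← ENNReal.ofReal_mul (by positivity)]
    · congr 1
      funext x
      rw [ite_mul, zero_mul, ← ENNReal.ofReal_mul (hu0 x)]
  have hm1 : Measurable (Function.uncurry fun (t : ℝ) (x : Ω) =>
      if u x ≤ t then ENNReal.ofReal (u x ^ 2 * t ^ (p - 3)) else 0) :=
    Measurable.ite (measurableSet_le (by fun_prop) (by fun_prop)) (by fun_prop) (by fun_prop)
  have hm2 : Measurable (Function.uncurry fun (t : ℝ) (x : Ω) =>
      if t / 2 < u x then ENNReal.ofReal (u x * t ^ (p - 2)) else 0) :=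
    Measurable.ite (measurableSet_lt (by fun_prop) (by fun_prop)) (by fun_prop) (by fun_prop)
  refine (setLIntegral_mono' measurableSet_Ioi key).trans ?_
  rw [lintegral_add_left hm1.lintegral_prod_right, lintegral_const_mul _ hm2.lintegral_prod_right,
    lintegral_lintegral_swap hm1.aemeasurable, lintegral_lintegral_swap hm2.aemeasurable, add_mul,
    mul_assoc c]
  have hup : Measurable fun x => ENNReal.ofReal (u x ^ p) := by fun_prop
  gcongr
  · rw [← lintegral_const_mul _ hup]
    exact lintegral_mono fun x => lintegral_Ioi_indicator_rpow_sub_three hp2 (hu0 x)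
  · rw [← lintegral_const_mul _ hup]
    exact lintegral_mono fun x => lintegral_Ioi_indicator_rpow_sub_two hp1 (hu0 x)

end Interpolation

/-! ### Density of simple martingales and extension to `L^p` -/

section Extension

variable {Ω : Type*} {m0 : MeasurableSpace Ω} {μ : Measure Ω} {ℱ : Filtration ℕ m0}
variable {𝕜 : Type*} [RCLike 𝕜] {H : Type*} [NormedAddCommGroup H] [InnerProductSpace 𝕜 H]
  [NormedSpace ℝ H] [CompleteSpace H]

/-- The limit function of a simple martingale. -/
noncomputable def SimpleMartingale.limit (f : SimpleMartingale μ ℱ 𝕜 H) : Ω → H :=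
  (f : ℕ → Ω → H) (SimpleMartingale.exists_forall_ge_eq f).choose

theorem SimpleMartingale.eventually_eq_limit (f : SimpleMartingale μ ℱ 𝕜 H) :
    ∀ᶠ n in atTop, (f : ℕ → Ω → H) n = (SimpleMartingale.limit f) := by
  filter_upwards [eventually_ge_atTop (SimpleMartingale.exists_forall_ge_eq f).choose] with n hn
  exact (SimpleMartingale.exists_forall_ge_eq f).choose_spec n hn

theorem SimpleMartingale.limit_add (f g : SimpleMartingale μ ℱ 𝕜 H) :
    (SimpleMartingale.limit (f + g)) = (SimpleMartingale.limit f) + (SimpleMartingale.limit g) := by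
  obtain ⟨n, h1, h2, h3⟩ := ((SimpleMartingale.eventually_eq_limit f).and
    ((SimpleMartingale.eventually_eq_limit g).and (SimpleMartingale.eventually_eq_limit (f + g)))).exists
  rw [← h1, ← h2, ← h3]
  rfl

theorem SimpleMartingale.limit_smul (c : 𝕜) (f : SimpleMartingale μ ℱ 𝕜 H) :
    (SimpleMartingale.limit (c • f)) = c • (SimpleMartingale.limit f) := by
  obtain ⟨n, h1, h2⟩ := ((SimpleMartingale.eventually_eq_limit f).and (SimpleMartingale.eventually_eq_limit (c • f))).exists
  rw [← h1, ← h2]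
  rfl

theorem SimpleMartingale.exists_stronglyMeasurable_limit (f : SimpleMartingale μ ℱ 𝕜 H) :
    ∃ n, StronglyMeasurable[ℱ n] (SimpleMartingale.limit f) :=
  ⟨_, f.2.1.1 _⟩

theorem SimpleMartingale.memLp_limit [IsFiniteMeasure μ]
    (hfin : ∀ n, {s : Set Ω | MeasurableSet[ℱ n] s}.Finite)
    (f : SimpleMartingale μ ℱ 𝕜 H) (p : ℝ≥0∞) : MemLp (SimpleMartingale.limit f) p μ := by
  obtain ⟨n, hn⟩ := (SimpleMartingale.exists_stronglyMeasurable_limit f)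
  exact memLp_of_stronglyMeasurable_of_finite (ℱ.le n) (hfin n) hn p

theorem SimpleMartingale.martingaleNorm_eq {p : ℝ≥0∞} (hp : 1 ≤ p)
    (f : SimpleMartingale μ ℱ 𝕜 H) :
    martingaleNorm μ p (f : ℕ → Ω → H) = eLpNorm (SimpleMartingale.limit f) p μ :=
  martingaleNorm_eq_of_eventually f.2.1 (SimpleMartingale.exists_forall_ge_eq f).choose_spec hp

variable (p : ℝ≥0∞)

/-- The identification of simple martingales with their limit functions in `L^p`. -/
noncomputable def SimpleMartingale.toLpMeas [IsFiniteMeasure μ]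
    (hfin : ∀ n, {s : Set Ω | MeasurableSet[ℱ n] s}.Finite) :
    SimpleMartingale μ ℱ 𝕜 H →ₗ[𝕜] lpMeas H 𝕜 (⨆ n, ℱ n) p μ where
  toFun f := ⟨(SimpleMartingale.memLp_limit hfin f p).toLp (SimpleMartingale.limit f), by
    obtain ⟨n, hn⟩ := (SimpleMartingale.exists_stronglyMeasurable_limit f)
    exact ⟨(SimpleMartingale.limit f), hn.mono (le_iSup (fun n => (ℱ n : MeasurableSpace Ω)) n),
      MemLp.coeFn_toLp _⟩⟩
  map_add' f g := by
    ext1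
    refine Eq.trans ?_ (MemLp.toLp_add (SimpleMartingale.memLp_limit hfin f p)
      (SimpleMartingale.memLp_limit hfin g p))
    exact MemLp.toLp_congr (SimpleMartingale.memLp_limit hfin (f + g) p) _
      (Eq.eventuallyEq (SimpleMartingale.limit_add f g))
  map_smul' c f := by
    ext1
    refine Eq.trans ?_ (MemLp.toLp_const_smul c (SimpleMartingale.memLp_limit hfin f p))
    exact MemLp.toLp_congr (SimpleMartingale.memLp_limit hfin (c • f) p) _
      (Eq.eventuallyEq (SimpleMartingale.limit_smul c f))

variable {p}

theorem SimpleMartingale.coeFn_toLpMeas [IsFiniteMeasure μ]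
    (hfin : ∀ n, {s : Set Ω | MeasurableSet[ℱ n] s}.Finite) (f : SimpleMartingale μ ℱ 𝕜 H) :
    ((SimpleMartingale.toLpMeas p hfin f : Lp H p μ) : Ω → H) =ᵐ[μ] (SimpleMartingale.limit f) :=
  MemLp.coeFn_toLp (SimpleMartingale.memLp_limit hfin f p)

/-- The union of the filtration is an algebra of sets that generates `⨆ n, ℱ n`. -/
theorem measureDense_iUnion_filtration [IsFiniteMeasure μ] (ℱ : Filtration ℕ m0)
    (hle : ⨆ n, (ℱ n : MeasurableSpace Ω) ≤ m0) :
    @Measure.MeasureDense Ω (⨆ n, (ℱ n : MeasurableSpace Ω)) (μ.trim hle)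
      {s | ∃ n, MeasurableSet[ℱ n] s} := by
  refine @Measure.MeasureDense.of_generateFrom_isSetAlgebra_finite Ω
    (⨆ n, (ℱ n : MeasurableSpace Ω)) (μ.trim hle) _ _ ?_ ?_
  · refine ⟨⟨0, @MeasurableSet.empty Ω (ℱ 0)⟩, fun s ⟨n, hs⟩ => ⟨n, hs.compl⟩, ?_⟩
    rintro s t ⟨n, hs⟩ ⟨m, ht⟩
    exact ⟨max n m, (ℱ.mono (le_max_left n m) _ hs).union (ℱ.mono (le_max_right n m) _ ht)⟩
  · rw [← MeasurableSpace.generateFrom_iUnion_measurableSet]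
    congr 1
    ext s
    simp

theorem SimpleMartingale.denseRange_toLpMeas [IsFiniteMeasure μ] [Fact (1 ≤ p)] (hp : p ≠ ∞)
    (hfin : ∀ n, {s : Set Ω | MeasurableSet[ℱ n] s}.Finite) :
    DenseRange (SimpleMartingale.toLpMeas (μ := μ) (𝕜 := 𝕜) (H := H) p hfin) := by
  set e := SimpleMartingale.toLpMeas (μ := μ) (𝕜 := 𝕜) (H := H) p hfin
  have hle : ⨆ n, (ℱ n : MeasurableSpace Ω) ≤ m0 := iSup_le ℱ.le
  set W : Submodule 𝕜 (Lp H p μ) := LinearMap.range ((lpMeas H 𝕜 (⨆ n, ℱ n) p μ).subtype ∘ₗ e)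
  have hp0 : p ≠ 0 := (zero_lt_one.trans_le (Fact.out : 1 ≤ p)).ne'
  -- The martingale of conditional expectations of such an indicator is constant from time `n` on,
  -- hence simple.
  have hind : ∀ (c : H) {s : Set Ω} {n : ℕ} (hs : MeasurableSet[ℱ n] s),
      indicatorConstLp p (ℱ.le n s hs) (measure_ne_top μ s) c ∈ W := by
    intro c s n hs
    have hsm : StronglyMeasurable[ℱ n] (s.indicator fun _ => c) :=
      stronglyMeasurable_const.indicator hs
    have hint : Integrable (s.indicator fun _ => c) μ :=
      (integrable_const c).indicator (ℱ.le n s hs)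
    have hk : ∀ k, n ≤ k → (μ[s.indicator fun _ => c | ℱ k]) = s.indicator fun _ => c :=
      fun k hk => condExp_of_stronglyMeasurable (ℱ.le k) (hsm.mono (ℱ.mono hk)) hint
    let f : SimpleMartingale μ ℱ 𝕜 H :=
      ⟨fun k => μ[s.indicator fun _ => c | ℱ k], martingale_condExp _ ℱ μ, n, fun k hnk => by
        exact (hk (k + 1) (hnk.trans k.le_succ)).trans (hk k hnk).symm⟩
    refine ⟨f, ?_⟩
    refine MemLp.toLp_congr (SimpleMartingale.memLp_limit hfin f p) _ (Eq.eventuallyEq ?_)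
    obtain ⟨k, h1, h2⟩ := ((SimpleMartingale.eventually_eq_limit f).and (eventually_ge_atTop n)).exists
    rw [← h1]
    exact hk k h2
  have hmem : ∀ F : Lp H p μ, AEStronglyMeasurable[⨆ n, (ℱ n : MeasurableSpace Ω)] F μ →
      F ∈ W.topologicalClosure := by
    refine Lp.induction_stronglyMeasurable_aux hle hp _ ?_ ?_ ?_
    · intro c s hs hμs
      rw [Lp.simpleFunc.coe_indicatorConst]
      rcases eq_or_ne c 0 with rfl | hc
      · have : indicatorConstLp p (hle s hs) hμs.ne (0 : H) = 0 := by
          simp [indicatorConstLp]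
        rw [this]
        exact zero_mem _
      change _ ∈ closure (W : Set (Lp H p μ))
      refine Metric.mem_closure_iff.2 fun ε hε => ?_
      -- Two indicators with value `c` are at `L^p` distance `‖c‖ μ(s ∆ t) ^ (1 / p)`, so this
      -- tolerance for the measure makes the distance less than `ε`.
      have hη : 0 < (ε / ‖c‖) ^ p.toReal := Real.rpow_pos_of_pos (div_pos hε (norm_pos_iff.2 hc)) _
      obtain ⟨t, ⟨n, ht⟩, hst⟩ := Measure.MeasureDense.approx (m := ⨆ n, (ℱ n : MeasurableSpace Ω))
        (measureDense_iUnion_filtration (μ := μ) ℱ hle) s hs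
        (by rw [trim_measurableSet_eq hle hs]; exact hμs.ne) _ hη
      refine ⟨_, hind c ht, ?_⟩
      rw [trim_measurableSet_eq hle
        (hs.symmDiff (le_iSup (fun n => (ℱ n : MeasurableSpace Ω)) n _ ht))] at hst
      rw [dist_indicatorConstLp_eq_norm, norm_indicatorConstLp hp0 hp]
      have hpos := ENNReal.toReal_pos hp0 hp
      have h1 : μ.real (symmDiff s t) < (ε / ‖c‖) ^ p.toReal :=
        (ENNReal.lt_ofReal_iff_toReal_lt (measure_ne_top _ _)).1 hst
      calc ‖c‖ * μ.real (symmDiff s t) ^ (1 / p.toReal)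
          < ‖c‖ * ((ε / ‖c‖) ^ p.toReal) ^ (1 / p.toReal) := by
            have := norm_pos_iff.2 hc
            gcongr
        _ = ε := by
            rw [one_div, Real.rpow_rpow_inv (by positivity) hpos.ne',
              mul_div_cancel₀ _ (norm_ne_zero_iff.2 hc)]
    · intro f g hf hg _ _ _ hfW hgW
      exact add_mem hfW hgW
    · exact W.isClosed_topologicalClosure.preimage continuous_subtype_val
  intro F
  rw [closure_subtype]
  refine closure_mono ?_ (hmem F (lpMeas.aestronglyMeasurable F))
  rintro _ ⟨f, rfl⟩
  exact ⟨e f, ⟨f, rfl⟩, rfl⟩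

/-- A linear operator on simple martingales that is bounded in the `L^p` norm extends to the whole
of `L^p`. -/
theorem SimpleMartingale.exists_extension [IsFiniteMeasure μ] [Fact (1 ≤ p)] (hp : p ≠ ∞)
    (hfin : ∀ n, {s : Set Ω | MeasurableSet[ℱ n] s}.Finite)
    (T : SimpleMartingale μ ℱ 𝕜 H →ₗ[𝕜] (Ω →ₘ[μ] 𝕜)) (C : ℝ≥0)
    (hT : ∀ f, eLpNorm (T f) p μ ≤ C * martingaleNorm μ p (f : ℕ → Ω → H)) :
    ∃ T' : lpMeas H 𝕜 (⨆ n, ℱ n) p μ →L[𝕜] Lp 𝕜 p μ, ‖T'‖ ≤ C ∧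
      ∀ f : SimpleMartingale μ ℱ 𝕜 H, ∃ F : lpMeas H 𝕜 (⨆ n, ℱ n) p μ,
        Tendsto (fun n => eLpNorm ((f : ℕ → Ω → H) n - ((F : Lp H p μ) : Ω → H)) p μ)
          atTop (𝓝 0) ∧ (T' F : Ω → 𝕜) =ᵐ[μ] T f := by
  have hp1 : 1 ≤ p := Fact.out
  set e := SimpleMartingale.toLpMeas (μ := μ) (𝕜 := 𝕜) (H := H) p hfin
  have hT' : ∀ f, eLpNorm (T f) p μ ≤ C * eLpNorm (SimpleMartingale.limit f) p μ := fun f => by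
    rw [← SimpleMartingale.martingaleNorm_eq hp1 f]
    exact hT f
  have hfinite : ∀ f : SimpleMartingale μ ℱ 𝕜 H, C * eLpNorm (SimpleMartingale.limit f) p μ ≠ ∞ := fun f =>
    ENNReal.mul_ne_top ENNReal.coe_ne_top (SimpleMartingale.memLp_limit hfin f p).eLpNorm_ne_top
  let A : SimpleMartingale μ ℱ 𝕜 H →ₗ[𝕜] Lp 𝕜 p μ :=
    { toFun := fun f => ⟨T f, Lp.mem_Lp_iff_eLpNorm_lt_top.2
        ((hT' f).trans_lt (hfinite f).lt_top)⟩
      map_add' := fun f g => Subtype.ext (map_add T f g)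
      map_smul' := fun c f => Subtype.ext (map_smul T c f) }
  have hA : ∀ f, ‖A f‖ ≤ C * ‖e f‖ := fun f => by
    have h1 : ‖A f‖ = (eLpNorm (T f) p μ).toReal := Lp.norm_def _
    have h2 : ‖e f‖ = (eLpNorm (SimpleMartingale.limit f) p μ).toReal :=
      Lp.norm_toLp _ (SimpleMartingale.memLp_limit hfin f p)
    rw [h1, h2, ← ENNReal.coe_toReal C, ← ENNReal.toReal_mul]
    exact ENNReal.toReal_mono (hfinite f) (hT' f)
  have hdense : DenseRange e := SimpleMartingale.denseRange_toLpMeas hp hfin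
  -- Injectivity of `e` is not needed: by `hA`, the map `A` vanishes on the kernel of `e` and
  -- factors through its dense range.
  refine ⟨A.extendOfNorm e, LinearMap.opNorm_extendOfNorm_le hdense C.coe_nonneg hA,
    fun f => ⟨e f, ?_, ?_⟩⟩
  · refine tendsto_const_nhds.congr' ?_
    filter_upwards [(SimpleMartingale.eventually_eq_limit f)] with n hn
    rw [hn, eLpNorm_congr_ae
      (EventuallyEq.rfl.sub (SimpleMartingale.coeFn_toLpMeas hfin f)), sub_self, eLpNorm_zero]
  · rw [LinearMap.extendOfNorm_eq hdense ⟨C, hA⟩]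
    exact EventuallyEq.rfl

end Extension

/-! ### The `L^p` bound and the main theorem -/

section Bound

variable {Ω : Type*} {m0 : MeasurableSpace Ω} {μ : Measure Ω} {ℱ : Filtration ℕ m0}
variable {𝕜 : Type*} [RCLike 𝕜] {H : Type*} [NormedAddCommGroup H] [InnerProductSpace 𝕜 H]
  [NormedSpace ℝ H] [CompleteSpace H]

theorem lintegral_ofReal_norm_rpow_eq {E : Type*} [NormedAddCommGroup E] {p : ℝ≥0∞}
    (hp0 : p ≠ 0) (hp : p ≠ ∞) (f : Ω → E) :
    ∫⁻ x, ENNReal.ofReal (‖f x‖ ^ p.toReal) ∂μ = eLpNorm f p μ ^ p.toReal := by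
  rw [eLpNorm_eq_lintegral_rpow_enorm_toReal hp0 hp, ← ENNReal.rpow_mul,
    one_div_mul_cancel (ENNReal.toReal_pos hp0 hp).ne', ENNReal.rpow_one]
  refine lintegral_congr fun x => ?_
  rw [← ofReal_norm, ENNReal.ofReal_rpow_of_nonneg (norm_nonneg _) ENNReal.toReal_nonneg]

/-- The constant to which the interpolation argument leads, for the exponent `p < 2`. -/
noncomputable def interpolationConst (p δ : ℝ) : ℝ≥0∞ :=
  ENNReal.ofReal p * (ENNReal.ofReal (1 / (2 - p)) +
    ENNReal.ofReal (2 * (1 + (δ ^ 2)⁻¹)) * ENNReal.ofReal (2 ^ (p - 1) / (p - 1)))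

theorem interpolationConst_ne_top (p δ : ℝ) : interpolationConst p δ ≠ ∞ := by
  unfold interpolationConst
  finiteness

/-- The norm bound for operators of Gundy's class on `L^p`, for `1 < p < 2`. -/
theorem IsGundy.eLpNorm_le [IsFiniteMeasure μ] {δ : ℝ} (hR : IsRegular μ ℱ δ)
    (hδ0 : 0 < δ) (hδ1 : δ ≤ 1) {T : SimpleMartingale μ ℱ 𝕜 H →ₗ[𝕜] (Ω →ₘ[μ] 𝕜)} (hT : IsGundy T)
    {p : ℝ≥0∞} (hp1 : 1 < p) (hp2 : p < 2) (f : SimpleMartingale μ ℱ 𝕜 H) :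
    eLpNorm (T f) p μ ≤ interpolationConst p.toReal δ ^ (1 / p.toReal) *
      martingaleNorm μ p (f : ℕ → Ω → H) := by
  have hptop : p ≠ ∞ := (hp2.trans ENNReal.ofNat_lt_top).ne
  have hp0 : p ≠ 0 := (zero_lt_one.trans hp1).ne'
  have hr1 : 1 < p.toReal := by
    rw [← ENNReal.toReal_one]
    exact (ENNReal.toReal_lt_toReal ENNReal.one_ne_top hptop).2 hp1
  have hr2 : p.toReal < 2 := by
    rw [← ENNReal.toReal_ofNat 2]
    exact (ENNReal.toReal_lt_toReal hptop ENNReal.ofNat_ne_top).2 hp2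
  obtain ⟨N, hN⟩ := (SimpleMartingale.exists_forall_ge_eq f)
  have hmeas : Measurable fun x => ‖(f : ℕ → Ω → H) N x‖ :=
    ((f.2.1.1 N).mono (ℱ.le N)).norm.measurable
  have key := lintegral_rpow_le_of_distribution_le hr1 hr2 hmeas (fun x => norm_nonneg _)
    (T f).aestronglyMeasurable.norm.aemeasurable (fun x => norm_nonneg _) _
    fun t ht => hT.measure_lt_norm_le hR hδ0 hδ1 f hN ht
  rw [lintegral_ofReal_norm_rpow_eq hp0 hptop, lintegral_ofReal_norm_rpow_eq hp0 hptop] at key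
  have hr0 : 0 < p.toReal := by linarith
  rw [martingaleNorm_eq_of_eventually f.2.1 hN hp1.le]
  have := ENNReal.rpow_le_rpow key (z := 1 / p.toReal) (by positivity)
  rwa [ENNReal.mul_rpow_of_nonneg _ _ (by positivity), ← ENNReal.rpow_mul, ← ENNReal.rpow_mul,
    mul_one_div_cancel hr0.ne', ENNReal.rpow_one, ENNReal.rpow_one] at this

end Bound

theorem isFiniteMeasure_lebesgueOn {I : Set ℝ} (hI : I.OrdConnected)
    (hb : Bornology.IsBounded I) : IsFiniteMeasure (lebesgueOn I) := by
  refine ⟨?_⟩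
  rw [lebesgueOn, comap_subtype_coe_apply hI.measurableSet]
  exact (measure_mono (Set.image_subset_range _ _)).trans_lt
    (by rw [Subtype.range_coe]; exact hb.measure_lt_top)

end Gundy

theorem mainTheorem2 (p : ℝ≥0∞) [Fact (1 ≤ p)] (hp1 : 1 < p) (hp2 : p ≤ 2)
    (δ : ℝ) (hδ0 : 0 < δ) (hδ : δ ≤ 1 / 2) :
    ∃ C : ℝ≥0,
      ∀ (𝕜 : Type*) [RCLike 𝕜] (H : Type*) [NormedAddCommGroup H] [InnerProductSpace 𝕜 H]
        [NormedSpace ℝ H] [CompleteSpace H] [TopologicalSpace.SeparableSpace H]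
        (I : Set ℝ) (_ : I.OrdConnected) (_ : Bornology.IsBounded I)
        (_ : 0 < (volume : Measure ℝ) I)
        (ℱ : Filtration ℕ (inferInstance : MeasurableSpace I))
        (_ : Gundy.IsRegular (Gundy.lebesgueOn I) ℱ δ)
        (T : Gundy.SimpleMartingale (Gundy.lebesgueOn I) ℱ 𝕜 H →ₗ[𝕜]
          (I →ₘ[Gundy.lebesgueOn I] 𝕜))
        (_ : Gundy.IsGundy T),
        (∀ f : Gundy.SimpleMartingale (Gundy.lebesgueOn I) ℱ 𝕜 H,
          eLpNorm (T f) p (Gundy.lebesgueOn I) ≤ C * Gundy.martingaleNorm (Gundy.lebesgueOn I) p (f : ℕ → I → H)) ∧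
        ∃ T' : lpMeas H 𝕜 (⨆ n, ℱ n) p (Gundy.lebesgueOn I) →L[𝕜]
            Lp 𝕜 p (Gundy.lebesgueOn I),
          ‖T'‖ ≤ C ∧
          ∀ f : Gundy.SimpleMartingale (Gundy.lebesgueOn I) ℱ 𝕜 H,
            ∃ F : lpMeas H 𝕜 (⨆ n, ℱ n) p (Gundy.lebesgueOn I),
              Tendsto (fun n => eLpNorm ((f : ℕ → I → H) n - ((F : Lp H p (Gundy.lebesgueOn I)) : I → H))
                p (Gundy.lebesgueOn I)) atTop (𝓝 0) ∧
              (T' F : I → 𝕜) =ᵐ[Gundy.lebesgueOn I] T f := by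
  -- The `1` serves `p = 2`, where (G1) gives the bound; the other term serves `p < 2`.
  refine ⟨max 1 (Gundy.interpolationConst p.toReal δ ^ (1 / p.toReal)).toNNReal, ?_⟩
  intro 𝕜 _ H _ _ _ _ _ I hI hb _ ℱ hR T hT
  have := Gundy.isFiniteMeasure_lebesgueOn hI hb
  have hptop : p ≠ ∞ := (hp2.trans_lt ENNReal.ofNat_lt_top).ne
  suffices hbound : ∀ f : Gundy.SimpleMartingale (Gundy.lebesgueOn I) ℱ 𝕜 H,
      eLpNorm (T f) p (Gundy.lebesgueOn I) ≤
        (max 1 (Gundy.interpolationConst p.toReal δ ^ (1 / p.toReal)).toNNReal : ℝ≥0) *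
          Gundy.martingaleNorm (Gundy.lebesgueOn I) p (f : ℕ → I → H) from
    ⟨hbound, Gundy.SimpleMartingale.exists_extension hptop hR.finite T _ hbound⟩
  intro f
  rcases hp2.lt_or_eq with hp2 | rfl
  · refine (hT.eLpNorm_le hR hδ0 (by linarith) hp1 hp2 f).trans ?_
    gcongr
    refine le_trans (ENNReal.coe_toNNReal ?_).ge (ENNReal.coe_le_coe.2 (le_max_right _ _))
    exact ENNReal.rpow_ne_top_of_nonneg (by positivity) (Gundy.interpolationConst_ne_top _ _)
  · refine (hT.norm_le f).trans (le_mul_of_one_le_left' ?_)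
    exact_mod_cast le_max_left (1 : ℝ≥0) _
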